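/- Let $d\ge 1$ and $k\ge 0$ be integers, and let $\mathbb{S}^{d-1}$ be the unit sphere of $\mathbb{R}^d$ with the uniform probability distribution. Let $\mathbb{Y}_{k,d}$ be the space of degree-$k$ spherical harmonics on $\mathbb{S}^{d-1}$, that is, the restrictions to $\mathbb{S}^{d-1}$ of the real harmonic homogeneous polynomials of degree $k$ in $d$ variables, and let $N_{k,d}$ be its dimension. Let $\|g\|_\infty=\sup_{x\in\mathbb{S}^{d-1}}|g(x)|$ and $\|g\|_2=\left(\mathbb{E}_{x\sim\mathbb{S}^{d-1}}[g(x)^2]\right)^{1/2}$. Let $\{Y_{k,j}\}_{j=1}^{N_{k,d}}$ be any basis of $\mathbb{Y}_{k,d}$ that is orthonormal for the inner product $\langle g,h\rangle=\mathbb{E}_{x\sim\mathbb{S}^{d-1}}[g(x)h(x)]$, and let $$g=\sum_{j=1}^{N_{k,d}}a_jY_{k,j},$$ where $a_1,\dots,a_{N_{k,d}}$ are independent $\mathcal{N}(0,1)$ random variables. Then for every $\delta>0$, with probability at least $1-\delta$, $$\|g\|_\infty\le 5\sqrt{\ln(3/\delta)+2d^2\ln(k+1)}\;\|g\|_2 .$$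 (For $\delta\ge 1$ the claim is trivial.) -/

import Mathlib

open MeasureTheory ProbabilityTheory
open scoped ENNReal

noncomputable section

/-- The unit sphere `S^{d-1}` of Euclidean space `ℝ^d`. -/
abbrev UnitSphere (d : ℕ) : Type := Metric.sphere (0 : EuclideanSpace ℝ (Fin d)) 1

/-- The uniform distribution on the unit sphere: surface measure divided by its total mass. -/
def sphereUniform (d : ℕ) : Measure (UnitSphere d) :=
  ((volume : Measure (EuclideanSpace ℝ (Fin d))).toSphere Set.univ)⁻¹ •
    (volume : Measure (EuclideanSpace ℝ (Fin d))).toSphere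

/-- The Laplacian `∑ i, ∂²/∂x_i²` on real polynomials in `d` variables. -/
def polyLaplacian (d : ℕ) : MvPolynomial (Fin d) ℝ →ₗ[ℝ] MvPolynomial (Fin d) ℝ :=
  ∑ i : Fin d, (MvPolynomial.pderiv i).toLinearMap ∘ₗ (MvPolynomial.pderiv i).toLinearMap

/-- The restriction of a polynomial, viewed as a function on `ℝ^d`, to the unit sphere. -/
def restrictToSphere (d : ℕ) : MvPolynomial (Fin d) ℝ →ₗ[ℝ] (UnitSphere d → ℝ) where
  toFun p := fun x => MvPolynomial.eval (fun i => (x : EuclideanSpace ℝ (Fin d)) i) p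
  map_add' p q := by ext x; simp
  map_smul' c p := by ext x; simp

/-- The space of degree-`k` spherical harmonics on `S^{d-1}`: the restrictions to the sphere of
the harmonic homogeneous polynomials of degree `k` in `d` variables. -/
def sphericalHarmonics (d k : ℕ) : Submodule ℝ (UnitSphere d → ℝ) :=
  (MvPolynomial.homogeneousSubmodule (Fin d) ℝ k ⊓ LinearMap.ker (polyLaplacian d)).map
    (restrictToSphere d)

/-- The inner product `⟨g, h⟩ = E_x [g(x) h(x)]` for `x` uniform on the sphere. -/
def sphereInner (d : ℕ) (g h : UnitSphere d → ℝ) : ℝ := ∫ x, g x * h x ∂(sphereUniform d)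

/-- The norm `‖g‖_2 = (E_x |g(x)|^2)^{1/2}` for `x` uniform on the sphere. -/
def sphereL2Norm (d : ℕ) (g : UnitSphere d → ℝ) : ℝ≥0∞ := eLpNorm g 2 (sphereUniform d)

/-- The norm `‖g‖_∞`, as a supremum over all points of the sphere (for continuous functions,
such as spherical harmonics, this is also the essential supremum). -/
def sphereSupNorm (d : ℕ) (g : UnitSphere d → ℝ) : ℝ≥0∞ := ⨆ x, ‖g x‖ₑ

end

/-! ### Standard Gaussian vectors -/

section GaussianVector

variable {ι : Type*} [Fintype ι]

/-! The proof is a moment method in place of an ε-net. For an orthonormal basis, `‖g‖₂` is the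
length `|a|`. The sum `∑ Y_j(x)²` does not depend on `x`, since it is the diagonal of a rotation
invariant reproducing kernel; so it equals the dimension `N`. Hence `g(x)` is `N(0, N)` at every
point, and the `p`-th moment of `g(x)²/|a|²` is at most the `2p`-th moment of a standard Gaussian,
itself at most `2(4p/e)^p` (`integral_ratio_pow_pi_gaussianReal_le`). By Tonelli the same bound
holds after averaging over `x`.

To pass from average to supremum, note that `g^p` is the restriction of a homogeneous polynomial of
degree `kp`. These restrictions form a rotation invariant space of dimension at most `(kp+1)^d`, so
the same kernel argument gives `sup g^(2p) ≤ (kp+1)^d · E g^(2p)`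
(`pow_two_mul_le_of_mem_sphericalHarmonics`). Markov's inequality with `p = ⌈5L⌉`, where `L =
ln(3/δ) + 2d² ln(k+1)`, finishes the proof. -/

theorem pi_gaussianReal_eq_withDensity :
    Measure.pi (fun _ : ι => gaussianReal 0 1) =
      (volume : Measure (ι → ℝ)).withDensity
        (fun a => ENNReal.ofReal (∏ i, gaussianPDFReal 0 1 (a i))) := by
  refine (Measure.pi_eq fun s hs => ?_)
  have h0 : ∀ a : ι → ℝ, 0 ≤ ∏ i, gaussianPDFReal 0 1 (a i) :=
    fun a => Finset.prod_nonneg fun i _ => gaussianPDFReal_nonneg _ _ _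
  rw [withDensity_apply _ (MeasurableSet.univ_pi hs), volume_pi, Measure.restrict_pi_pi,
    ← ofReal_integral_eq_lintegral_ofReal _ (ae_of_all _ h0), integral_fintype_prod_eq_prod,
    ENNReal.ofReal_prod_of_nonneg
      (fun i _ => integral_nonneg fun x => gaussianPDFReal_nonneg _ _ _)]
  · exact Finset.prod_congr rfl fun i _ =>
      (gaussianReal_apply_eq_integral 0 one_ne_zero (s i)).symm
  · exact Integrable.fintype_prod fun i => (integrable_gaussianPDFReal _ _).restrict

theorem prod_gaussianPDFReal (a : ι → ℝ) :
    ∏ i, gaussianPDFReal 0 1 (a i) =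
      (√(2 * Real.pi))⁻¹ ^ Fintype.card ι * Real.exp (-(∑ i, a i ^ 2) / 2) := by
  simp only [gaussianPDFReal, Finset.prod_mul_distrib, NNReal.coe_one, mul_one, sub_zero,
    Finset.prod_const, Finset.card_univ]
  rw [← Real.exp_sum, ← Finset.sum_div, Finset.sum_neg_distrib]

theorem integral_pi_gaussianReal (f : (ι → ℝ) → ℝ) :
    ∫ a, f a ∂Measure.pi (fun _ : ι => gaussianReal 0 1) =
      ∫ a, ((√(2 * Real.pi))⁻¹ ^ Fintype.card ι * Real.exp (-(∑ i, a i ^ 2) / 2)) * f a := by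
  rw [pi_gaussianReal_eq_withDensity]
  simp_rw [prod_gaussianPDFReal]
  rw [integral_withDensity_eq_integral_toReal_smul (by fun_prop)
    (ae_of_all _ fun _ => ENNReal.ofReal_lt_top)]
  refine integral_congr_ae (ae_of_all _ fun a => ?_)
  simp only [smul_eq_mul]
  rw [ENNReal.toReal_ofReal (by positivity)]

theorem integrable_sum_sq_pi_gaussianReal :
    Integrable (fun a : ι → ℝ => ∑ i, a i ^ 2) (Measure.pi fun _ : ι => gaussianReal 0 1) := by
  refine integrable_finsetSum _ fun i _ => ?_
  have h : Integrable (fun x : ℝ => x ^ 2) (gaussianReal 0 1) :=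
    (memLp_id_gaussianReal 2).integrable_sq
  exact integrable_comp_eval (μ := fun _ : ι => gaussianReal 0 1) (i := i) h

/-- Substitute `a ↦ c • a`: the Jacobian gives the power of `c`, and the exponential is the quotient
of the Gaussian densities at `c • a` and `a`. Comparing both sides as `c ↓ 1` replaces the
independence of direction and length. -/
theorem integral_homogeneous_mul_exp_pi_gaussianReal {h : (ι → ℝ) → ℝ}
    (hhom : ∀ c : ℝ, 0 < c → ∀ a, h (c • a) = h a) {c : ℝ} (hc : 0 < c) :
    ∫ a, h a * Real.exp (-((c ^ 2 - 1) / 2 * ∑ i, a i ^ 2))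
        ∂Measure.pi (fun _ : ι => gaussianReal 0 1) =
      (c ^ Fintype.card ι)⁻¹ * ∫ a, h a ∂Measure.pi (fun _ : ι => gaussianReal 0 1) := by
  rw [integral_pi_gaussianReal, integral_pi_gaussianReal]
  have := Measure.integral_comp_smul (volume : Measure (ι → ℝ))
    (fun a => ((√(2 * Real.pi))⁻¹ ^ Fintype.card ι * Real.exp (-(∑ i, a i ^ 2) / 2)) * h a) c
  rw [Module.finrank_fintype_fun_eq_card, abs_of_pos (by positivity), smul_eq_mul] at this
  rw [← this]
  refine integral_congr_ae (ae_of_all _ fun a => ?_)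
  simp only [hhom c hc, Pi.smul_apply, smul_eq_mul, mul_pow, ← Finset.mul_sum]
  have : Real.exp (-(c ^ 2 * ∑ i, a i ^ 2) / 2) =
      Real.exp (-(∑ i, a i ^ 2) / 2) * Real.exp (-((c ^ 2 - 1) / 2 * ∑ i, a i ^ 2)) := by
    rw [← Real.exp_add]; ring_nf
  rw [this]; ring

/-- A nonnegative function of the direction of a Gaussian vector is not negatively correlated
with its squared length. -/
theorem card_mul_integral_le_of_homogeneous {h : (ι → ℝ) → ℝ} (hm : Measurable h)
    (hhom : ∀ c : ℝ, 0 < c → ∀ a, h (c • a) = h a) (h0 : ∀ a, 0 ≤ h a) {C : ℝ}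
    (hC : ∀ a, h a ≤ C) :
    Fintype.card ι * ∫ a, h a ∂Measure.pi (fun _ : ι => gaussianReal 0 1) ≤
      ∫ a, h a * ∑ i, a i ^ 2 ∂Measure.pi (fun _ : ι => gaussianReal 0 1) := by
  set γ := Measure.pi (fun _ : ι => gaussianReal 0 1)
  set F := ∫ a, h a ∂γ
  set M := ∫ a, h a * ∑ i, a i ^ 2 ∂γ
  have hbd : ∀ a, ‖h a‖ ≤ C := fun a => by rw [Real.norm_of_nonneg (h0 a)]; exact hC a
  have hF0 : 0 ≤ F := integral_nonneg h0
  have hi : Integrable h γ := Integrable.of_bound hm.aestronglyMeasurable C (ae_of_all _ hbd)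
  have hiq : Integrable (fun a => h a * ∑ i, a i ^ 2) γ :=
    integrable_sum_sq_pi_gaussianReal.bdd_mul hm.aestronglyMeasurable (ae_of_all _ hbd)
  -- The scaling identity with `1 - s ≤ exp (-s)` on the left and Bernoulli for the power of `c`;
  -- the common factor `c - 1` is cancelled before `c ↓ 1`.
  have key : ∀ c : ℝ, 1 < c → (c ^ Fintype.card ι)⁻¹ * (Fintype.card ι * F) ≤ (c + 1) / 2 * M := by
    intro c hc
    have hc0 : 0 < c := by linarith
    have e1 := integral_homogeneous_mul_exp_pi_gaussianReal hhom hc0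
    have e2 : F - (c ^ 2 - 1) / 2 * M ≤ (c ^ Fintype.card ι)⁻¹ * F := by
      rw [← e1, ← integral_const_mul, ← integral_sub hi (hiq.const_mul _)]
      refine integral_mono (hi.sub (hiq.const_mul _)) ?_ fun a => ?_
      · refine hi.mul_bdd (c := 1) (Measurable.aestronglyMeasurable (by fun_prop)) (ae_of_all _ fun a => ?_)
        rw [Real.norm_of_nonneg (Real.exp_pos _).le, Real.exp_le_one_iff, neg_nonpos]
        have : 0 ≤ ∑ i, a i ^ 2 := Finset.sum_nonneg fun i _ => sq_nonneg _
        have : 0 ≤ c ^ 2 - 1 := by nlinarith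
        positivity
      · have := Real.add_one_le_exp (-((c ^ 2 - 1) / 2 * ∑ i, a i ^ 2))
        have := mul_le_mul_of_nonneg_left this (h0 a)
        simp only
        linarith
    have e3 : 1 + (Fintype.card ι : ℝ) * (c - 1) ≤ c ^ Fintype.card ι := by
      have := one_add_mul_le_pow (a := c - 1) (by linarith) (Fintype.card ι)
      simpa using this
    have hcN : 0 < c ^ Fintype.card ι := by positivity
    have e4 : (c - 1) * ((c ^ Fintype.card ι)⁻¹ * (Fintype.card ι * F)) ≤
        (c - 1) * ((c + 1) / 2 * M) := by
      have e5 : (c ^ Fintype.card ι)⁻¹ * (Fintype.card ι * (c - 1)) ≤ 1 - (c ^ Fintype.card ι)⁻¹ := by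
        rw [inv_mul_le_iff₀ hcN, mul_sub (c ^ _), mul_inv_cancel₀ hcN.ne']
        linarith
      have := mul_le_mul_of_nonneg_right e5 hF0
      nlinarith
    exact le_of_mul_le_mul_left e4 (by linarith)
  have l1 : Filter.Tendsto (fun c : ℝ => (c ^ Fintype.card ι)⁻¹ * (Fintype.card ι * F))
      (nhdsWithin 1 (Set.Ioi 1)) (nhds (((1 : ℝ) ^ Fintype.card ι)⁻¹ * (Fintype.card ι * F))) := by
    refine Filter.Tendsto.mono_left ?_ nhdsWithin_le_nhds
    refine Filter.Tendsto.mul_const _ (Filter.Tendsto.inv₀ ?_ (by simp))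
    exact (continuous_pow _).tendsto _
  have l2 : Filter.Tendsto (fun c : ℝ => (c + 1) / 2 * M)
      (nhdsWithin 1 (Set.Ioi 1)) (nhds (((1 : ℝ) + 1) / 2 * M)) :=
    Filter.Tendsto.mono_left (Continuous.tendsto (by fun_prop) _) nhdsWithin_le_nhds
  have := le_of_tendsto_of_tendsto l1 l2 (eventually_nhdsWithin_of_forall key)
  simpa using this

/-- This is `s ≤ exp (s - 1)` at `s = x²/(4p)`, raised to the power `p`. The rate `1/4` keeps the
right side Gaussian-integrable, with mean `√2 ≤ 2` for its exponential factor. -/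
theorem pow_two_mul_le_mul_exp {p : ℕ} (hp : 0 < p) (x : ℝ) :
    x ^ (2 * p) ≤ (4 * p * Real.exp (-1)) ^ p * Real.exp (x ^ 2 / 4) := by
  have hp' : (0 : ℝ) < p := by exact_mod_cast hp
  have h1 : x ^ 2 / (4 * p) ≤ Real.exp (x ^ 2 / (4 * p) - 1) := by
    have := Real.add_one_le_exp (x ^ 2 / (4 * p) - 1); linarith
  have h2 : x ^ 2 ≤ 4 * p * Real.exp (-1) * Real.exp (x ^ 2 / (4 * p)) := by
    rw [div_le_iff₀ (by positivity), sub_eq_neg_add, Real.exp_add] at h1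
    linarith
  calc x ^ (2 * p) = (x ^ 2) ^ p := pow_mul _ _ _
    _ ≤ (4 * p * Real.exp (-1) * Real.exp (x ^ 2 / (4 * p))) ^ p := by gcongr
    _ = _ := by
      rw [mul_pow _ (Real.exp _), ← Real.exp_nat_mul]
      congr 2
      field_simp

theorem integral_pow_two_mul_gaussianReal_le {p : ℕ} (hp : 0 < p) :
    ∫ x, x ^ (2 * p) ∂gaussianReal 0 1 ≤ 2 * (4 * p * Real.exp (-1)) ^ p := by
  have e : ∀ x : ℝ, gaussianPDFReal 0 1 x • Real.exp (x ^ 2 / 4) =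
      (√(2 * Real.pi))⁻¹ * Real.exp (-(1 / 4) * x ^ 2) := fun x => by
    simp only [gaussianPDFReal, NNReal.coe_one, mul_one, sub_zero, smul_eq_mul]
    rw [mul_assoc, ← Real.exp_add]; ring_nf
  have hint : Integrable (fun x : ℝ => Real.exp (x ^ 2 / 4)) (gaussianReal 0 1) := by
    rw [gaussianReal_of_var_ne_zero _ one_ne_zero,
      integrable_withDensity_iff_integrable_smul' (measurable_gaussianPDF _ _)
      (ae_of_all _ fun _ => gaussianPDF_lt_top)]
    simp_rw [toReal_gaussianPDF, e]
    exact (integrable_exp_neg_mul_sq (by norm_num)).const_mul _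
  have hval : ∫ x : ℝ, Real.exp (x ^ 2 / 4) ∂gaussianReal 0 1 ≤ 2 := by
    rw [integral_gaussianReal_eq_integral_smul one_ne_zero]
    simp_rw [e]
    rw [integral_const_mul, integral_gaussian, inv_mul_le_iff₀ (by positivity)]
    refine Real.sqrt_le_iff.2 ⟨by positivity, ?_⟩
    rw [mul_pow, Real.sq_sqrt (by positivity)]
    have := Real.pi_pos
    nlinarith
  have hpm : Integrable (fun x : ℝ => x ^ (2 * p)) (gaussianReal 0 1) := by
    refine (hint.const_mul ((4 * p * Real.exp (-1)) ^ p)).mono' (by fun_prop) (ae_of_all _ fun x => ?_)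
    rw [Real.norm_of_nonneg (by rw [pow_mul]; positivity)]
    exact pow_two_mul_le_mul_exp hp x
  calc _ ≤ ∫ x : ℝ, (4 * p * Real.exp (-1)) ^ p * Real.exp (x ^ 2 / 4) ∂gaussianReal 0 1 :=
        integral_mono hpm (hint.const_mul _) (pow_two_mul_le_mul_exp hp)
    _ = (4 * p * Real.exp (-1)) ^ p * ∫ x : ℝ, Real.exp (x ^ 2 / 4) ∂gaussianReal 0 1 :=
        integral_const_mul _ _
    _ ≤ _ := by
      rw [mul_comm 2]; gcongr

theorem map_sum_mul_pi_gaussianReal (v : ι → ℝ) :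
    (Measure.pi (fun _ : ι => gaussianReal 0 1)).map (fun a => ∑ i, a i * v i) =
      gaussianReal 0 (∑ i, v i ^ 2).toNNReal := by
  set w : EuclideanSpace ℝ ι := WithLp.toLp 2 v
  have h := IsGaussian.map_eq_gaussianReal (μ := stdGaussian (EuclideanSpace ℝ ι))
    (innerSL ℝ w)
  rw [integral_strongDual_stdGaussian, variance_dual_stdGaussian, ← map_pi_eq_stdGaussian,
    Measure.map_map (by fun_prop) (by fun_prop), innerSL_apply_norm,
    EuclideanSpace.norm_sq_eq] at h
  simp only [Real.norm_eq_abs, sq_abs] at h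
  rw [← h]
  congr 1

/-- Let `h` be the integrand. Then `h |a|^(2p) = (a·v)^(2p)`, and `a·v` is `√N` times a standard
Gaussian. Bernoulli bounds `|a|^(2p)` below by a function affine in `|a|²`, so the correlation
inequality between `h` and `|a|²` is enough. -/
theorem integral_ratio_pow_pi_gaussianReal_le [Nonempty ι] {v : ι → ℝ}
    (hv : ∑ i, v i ^ 2 = Fintype.card ι) {p : ℕ} (hp : 0 < p) :
    ∫ a, ((∑ i, a i * v i) ^ 2 / ∑ i, a i ^ 2) ^ p
        ∂Measure.pi (fun _ : ι => gaussianReal 0 1) ≤ 2 * (4 * p * Real.exp (-1)) ^ p := by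
  set γ := Measure.pi (fun _ : ι => gaussianReal 0 1)
  set N : ℝ := (Fintype.card ι : ℝ) with hN
  have hN0 : 0 < N := by simp [hN, Fintype.card_pos]
  set h : (ι → ℝ) → ℝ := fun a => ((∑ i, a i * v i) ^ 2 / ∑ i, a i ^ 2) ^ p with hh
  have q0 : ∀ a : ι → ℝ, 0 ≤ ∑ i, a i ^ 2 := fun a => Finset.sum_nonneg fun i _ => sq_nonneg _
  have hm : Measurable h := by fun_prop
  have h0 : ∀ a, 0 ≤ h a := fun a => pow_nonneg (div_nonneg (sq_nonneg _) (q0 a)) _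
  have hbd : ∀ a, h a ≤ N ^ p := fun a => by
    refine pow_le_pow_left₀ (div_nonneg (sq_nonneg _) (q0 a)) (div_le_of_le_mul₀ (q0 a) hN0.le ?_) _
    rw [mul_comm, ← hv]
    exact Finset.sum_mul_sq_le_sq_mul_sq _ _ _
  have hhom : ∀ c : ℝ, 0 < c → ∀ a, h (c • a) = h a := fun c hc a => by
    simp only [hh, Pi.smul_apply, smul_eq_mul, mul_pow, mul_assoc, ← Finset.mul_sum]
    rw [mul_div_mul_left _ _ (by positivity)]
  have hnb : ∀ a, ‖h a‖ ≤ N ^ p := fun a => by rw [Real.norm_of_nonneg (h0 a)]; exact hbd a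
  have hi : Integrable h γ := Integrable.of_bound hm.aestronglyMeasurable _ (ae_of_all _ hnb)
  have hiq : Integrable (fun a => h a * ∑ i, a i ^ 2) γ :=
    integrable_sum_sq_pi_gaussianReal.bdd_mul hm.aestronglyMeasurable (ae_of_all _ hnb)
  have hcorr := card_mul_integral_le_of_homogeneous hm hhom h0 hbd
  have hlin : Measurable (fun a : ι → ℝ => ∑ i, a i * v i) := by fun_prop
  have hmap := map_sum_mul_pi_gaussianReal v
  have hmap' : γ.map (fun a => ∑ i, a i * v i) = (gaussianReal 0 1).map (fun x => √N * x) := by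
    rw [hmap, gaussianReal_map_const_mul, hv]
    congr 1
    · simp
    · ext; simp [hN]
  have hmom_int : Integrable (fun a : ι → ℝ => (∑ i, a i * v i) ^ (2 * p)) γ := by
    have : Integrable (fun y : ℝ => y ^ (2 * p)) (γ.map (fun a => ∑ i, a i * v i)) := by
      rw [hmap]
      have := (memLp_id_gaussianReal (μ := 0) (v := (∑ i, v i ^ 2).toNNReal)
        ((2 * p : ℕ) : NNReal)).integrable_norm_pow'
      refine this.mono' (by fun_prop) (ae_of_all _ fun x => by simp)
    exact this.comp_aemeasurable hlin.aemeasurable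
  have hmom : ∫ a, (∑ i, a i * v i) ^ (2 * p) ∂γ = N ^ p * ∫ x, x ^ (2 * p) ∂gaussianReal 0 1 := by
    have e1 : ∫ a, (∑ i, a i * v i) ^ (2 * p) ∂γ =
        ∫ y, y ^ (2 * p) ∂(γ.map (fun a => ∑ i, a i * v i)) :=
      (integral_map hlin.aemeasurable
        (continuous_pow (2 * p)).aestronglyMeasurable).symm
    rw [e1, hmap', integral_map (by fun_prop) (by fun_prop), ← integral_const_mul]
    congr 1
    ext x
    rw [mul_pow, pow_mul (√N), Real.sq_sqrt hN0.le]
  have hpt : ∀ a, N ^ p * (h a + p * (h a * (∑ i, a i ^ 2) / N - h a)) ≤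
      (∑ i, a i * v i) ^ (2 * p) := fun a => by
    have e1 : h a * (∑ i, a i ^ 2) ^ p = (∑ i, a i * v i) ^ (2 * p) := by
      rcases (q0 a).eq_or_lt with hq | hq
      -- At `a = 0` the quotient is `0` by convention, and both sides vanish because `p > 0`.
      · have : ∀ i, a i = 0 := fun i => by
          have := (Finset.sum_eq_zero_iff_of_nonneg (fun i _ => sq_nonneg (a i))).1 hq.symm i
            (Finset.mem_univ i)
          exact pow_eq_zero_iff (two_ne_zero) |>.1 this
        simp [this, hp.ne']
      · simp only [hh]
        rw [← mul_pow, div_mul_cancel₀ _ hq.ne', pow_mul]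
    have e2 := one_add_mul_le_pow (a := (∑ i, a i ^ 2) / N - 1)
      (by have := div_nonneg (q0 a) hN0.le; linarith) p
    rw [add_sub_cancel, div_pow, le_div_iff₀ (by positivity)] at e2
    have e3 := mul_le_mul_of_nonneg_left e2 (h0 a)
    rw [e1] at e3
    refine le_trans (le_of_eq ?_) e3
    ring
  have hsub : Integrable (fun a => h a * (∑ i, a i ^ 2) / N - h a) γ := (hiq.div_const N).sub hi
  have hint := integral_mono ((hi.add (hsub.const_mul (p : ℝ))).const_mul (N ^ p)) hmom_int hpt
  have hcalc : ∫ a, N ^ p * (h a + p * (h a * (∑ i, a i ^ 2) / N - h a)) ∂γ =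
      N ^ p * (∫ a, h a ∂γ + p * ((∫ a, h a * (∑ i, a i ^ 2) ∂γ) / N - ∫ a, h a ∂γ)) := by
    rw [integral_const_mul, integral_add hi (hsub.const_mul _), integral_const_mul,
      integral_sub (hiq.div_const N) hi, integral_div]
  have hge : 0 ≤ (∫ a, h a * (∑ i, a i ^ 2) ∂γ) / N - ∫ a, h a ∂γ := by
    rw [sub_nonneg, le_div_iff₀ hN0, mul_comm]; exact hcorr
  have hfin : N ^ p * ∫ a, h a ∂γ ≤ N ^ p * ∫ x, x ^ (2 * p) ∂gaussianReal 0 1 := by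
    rw [← hmom]
    refine le_trans ?_ (hcalc ▸ hint)
    gcongr
    have : 0 ≤ (p : ℝ) * ((∫ a, h a * (∑ i, a i ^ 2) ∂γ) / N - ∫ a, h a ∂γ) := by positivity
    linarith
  exact (le_of_mul_le_mul_left hfin (by positivity)).trans (integral_pow_two_mul_gaussianReal_le hp)

end GaussianVector

/-! ### The uniform distribution on the sphere and its invariance -/

theorem isProbabilityMeasure_sphereUniform {d : ℕ} (hd : 1 ≤ d) :
    IsProbabilityMeasure (sphereUniform d) := by
  have : Nonempty (Fin d) := ⟨⟨0, hd⟩⟩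
  refine ⟨?_⟩
  rw [sphereUniform, Measure.smul_apply, smul_eq_mul]
  refine ENNReal.inv_mul_cancel ?_ (measure_ne_top _ _)
  rw [ne_eq, Measure.measure_univ_eq_zero]
  exact Measure.toSphere_ne_zero _

/-- The action of a linear isometry on the unit sphere. -/
noncomputable def sphereIsometry {d : ℕ} (ρ : EuclideanSpace ℝ (Fin d) ≃ₗᵢ[ℝ] EuclideanSpace ℝ (Fin d))
    (x : UnitSphere d) : UnitSphere d :=
  ⟨ρ x, by simp⟩

section SphereIsometry

variable {d : ℕ} (ρ : EuclideanSpace ℝ (Fin d) ≃ₗᵢ[ℝ] EuclideanSpace ℝ (Fin d))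

theorem continuous_sphereIsometry : Continuous (sphereIsometry ρ) := by
  unfold sphereIsometry
  fun_prop

theorem sphereIsometry_symm_apply (x : UnitSphere d) :
    sphereIsometry ρ (sphereIsometry ρ.symm x) = x := by
  ext1; simp [sphereIsometry]

theorem sphereIsometry_apply_symm (x : UnitSphere d) :
    sphereIsometry ρ.symm (sphereIsometry ρ x) = x := by
  ext1; simp [sphereIsometry]

open scoped Pointwise in
-- The surface measure of `s` is a multiple of the volume of the cone `(0,1) • s`, and a linear
-- isometry maps cones to cones and preserves volume.
theorem map_sphereIsometry_toSphere :
    (volume : Measure (EuclideanSpace ℝ (Fin d))).toSphere.map (sphereIsometry ρ) =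
      (volume : Measure (EuclideanSpace ℝ (Fin d))).toSphere := by
  ext s hs
  have hm := (continuous_sphereIsometry ρ).measurable
  rw [Measure.map_apply hm hs, Measure.toSphere_apply' _ (hm hs), Measure.toSphere_apply' _ hs]
  congr 1
  have hset : (Set.Ioo (0 : ℝ) 1 • (Subtype.val '' (sphereIsometry ρ ⁻¹' s)) :
      Set (EuclideanSpace ℝ (Fin d))) =
      ρ.toMeasurableEquiv ⁻¹' (Set.Ioo (0 : ℝ) 1 • (Subtype.val '' s)) := by
    ext y
    simp only [Set.mem_smul, Set.mem_image, Set.mem_preimage,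
      LinearIsometryEquiv.coe_toMeasurableEquiv]
    constructor
    · rintro ⟨c, hc, _, ⟨x, hx, rfl⟩, rfl⟩
      exact ⟨c, hc, _, ⟨_, hx, rfl⟩, by simp [sphereIsometry]⟩
    · rintro ⟨c, hc, _, ⟨x, hx, rfl⟩, h⟩
      refine ⟨c, hc, _, ⟨sphereIsometry ρ.symm x, ?_, rfl⟩, ?_⟩
      · rwa [sphereIsometry_symm_apply]
      · apply ρ.injective
        simpa [sphereIsometry] using h
  rw [hset]
  exact ρ.measurePreserving.measure_preimage_equiv (f := ρ.toMeasurableEquiv) _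

theorem integral_comp_sphereIsometry {f : UnitSphere d → ℝ} (hf : Continuous f) :
    ∫ x, f (sphereIsometry ρ x) ∂sphereUniform d = ∫ x, f x ∂sphereUniform d := by
  rw [← integral_map (continuous_sphereIsometry ρ).aemeasurable hf.aestronglyMeasurable]
  rw [sphereUniform, Measure.map_smul, map_sphereIsometry_toSphere]

end SphereIsometry

/-- Reflect in the hyperplane orthogonal to `x - y`; for `x = y` this is the identity. -/
theorem exists_sphereIsometry_eq {d : ℕ} (x y : UnitSphere d) : ∃ ρ, sphereIsometry ρ x = y := by
  refine ⟨(ℝ ∙ ((x : EuclideanSpace ℝ (Fin d)) - y))ᗮ.reflection, ?_⟩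
  ext1
  exact Submodule.reflection_sub (by simp)

instance isFiniteMeasure_sphereUniform (d : ℕ) : IsFiniteMeasure (sphereUniform d) := by
  rcases Nat.eq_zero_or_pos d with rfl | hd
  · have : IsEmpty (UnitSphere 0) := by
      refine ⟨fun x => ?_⟩
      have h := x.2
      rw [mem_sphere_zero_iff_norm, Subsingleton.elim (x : EuclideanSpace ℝ (Fin 0)) 0] at h
      simp at h
    rw [Measure.eq_zero_of_isEmpty (sphereUniform 0)]
    infer_instance
  · have := isProbabilityMeasure_sphereUniform hd
    infer_instance

theorem integrable_sphereUniform_of_continuous {d : ℕ} {f : UnitSphere d → ℝ} (hf : Continuous f) :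
    Integrable f (sphereUniform d) :=
  hf.integrable_of_hasCompactSupport (HasCompactSupport.of_compactSpace f)

/-! ### Reproducing kernels of rotation invariant function spaces -/

section Kernel

variable {d : ℕ} {κ : Type*} [Fintype κ] [DecidableEq κ] {e : κ → UnitSphere d → ℝ}

theorem sphereInner_comm (f g : UnitSphere d → ℝ) : sphereInner d f g = sphereInner d g f := by
  simp only [sphereInner, mul_comm]

theorem sphereInner_sum_sum (hc : ∀ i, Continuous (e i))
    (he : ∀ i j, sphereInner d (e i) (e j) = if i = j then 1 else 0) (a b : κ → ℝ) :
    sphereInner d (fun x => ∑ i, a i * e i x) (fun x => ∑ i, b i * e i x) = ∑ i, a i * b i := by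
  have h : ∀ x, (∑ i, a i * e i x) * (∑ i, b i * e i x) =
      ∑ i, ∑ j, (a i * b j) * (e i x * e j x) := fun x => by
    rw [Finset.sum_mul_sum]
    exact Finset.sum_congr rfl fun i _ => Finset.sum_congr rfl fun j _ => by ring
  have hint : ∀ i j, Integrable (fun x => (a i * b j) * (e i x * e j x)) (sphereUniform d) :=
    fun i j => (integrable_sphereUniform_of_continuous ((hc i).mul (hc j))).const_mul _
  simp only [sphereInner] at he ⊢
  simp_rw [h]
  rw [integral_finsetSum _ fun i _ => integrable_finsetSum _ fun j _ => hint i j]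
  refine Finset.sum_congr rfl fun i _ => ?_
  rw [integral_finsetSum _ fun j _ => hint i j]
  simp_rw [integral_const_mul, he]
  simp

theorem sq_le_sum_sq_mul_sphereInner (hc : ∀ i, Continuous (e i))
    (he : ∀ i j, sphereInner d (e i) (e j) = if i = j then 1 else 0) (a : κ → ℝ) (x : UnitSphere d) :
    (∑ i, a i * e i x) ^ 2 ≤
      (∑ i, e i x ^ 2) * sphereInner d (fun x => ∑ i, a i * e i x) (fun x => ∑ i, a i * e i x) := by
  rw [sphereInner_sum_sum hc he, mul_comm]
  simp_rw [← sq]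
  exact Finset.sum_mul_sq_le_sq_mul_sq _ _ _

/-- With `k` the reproducing kernel, pair `y ↦ k (ρx) (ρy)` with `k x` in two ways: reproducing at
`x` gives `k (ρx) (ρx)`, while moving `ρ` to the other factor and reproducing at `ρx` gives `k x x`.
-/
theorem sum_sq_sphereIsometry (hc : ∀ i, Continuous (e i))
    (he : ∀ i j, sphereInner d (e i) (e j) = if i = j then 1 else 0)
    (hinv : ∀ ρ, ∀ f ∈ Submodule.span ℝ (Set.range e),
      (fun x => f (sphereIsometry ρ x)) ∈ Submodule.span ℝ (Set.range e))
    (ρ : EuclideanSpace ℝ (Fin d) ≃ₗᵢ[ℝ] EuclideanSpace ℝ (Fin d)) (x : UnitSphere d) :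
    ∑ i, e i (sphereIsometry ρ x) ^ 2 = ∑ i, e i x ^ 2 := by
  set k : UnitSphere d → UnitSphere d → ℝ := fun x y => ∑ i, e i x * e i y with hk
  have hmem : ∀ f : UnitSphere d → ℝ, f ∈ Submodule.span ℝ (Set.range e) ↔
      ∃ a : κ → ℝ, f = fun x => ∑ i, a i * e i x := fun f => by
    rw [Submodule.mem_span_range_iff_exists_fun]
    refine exists_congr fun a => ⟨fun h => ?_, fun h => ?_⟩
    · rw [← h]; ext x; simp
    · rw [h]; ext x; simp
  have hcont : ∀ f ∈ Submodule.span ℝ (Set.range e), Continuous f := fun f hf => by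
    obtain ⟨a, rfl⟩ := (hmem f).1 hf
    exact continuous_finsetSum _ fun i _ => (hc i).const_mul _
  have hkm : ∀ x, k x ∈ Submodule.span ℝ (Set.range e) := fun x => (hmem _).2 ⟨_, rfl⟩
  have hrep : ∀ x, ∀ f ∈ Submodule.span ℝ (Set.range e), sphereInner d (k x) f = f x :=
    fun x f hf => by
      obtain ⟨a, rfl⟩ := (hmem f).1 hf
      rw [hk, sphereInner_sum_sum hc he]
      exact Finset.sum_congr rfl fun i _ => mul_comm _ _
  have hdiag : ∀ x, ∑ i, e i x ^ 2 = k x x := fun x => by simp only [hk, sq]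
  have h1 : sphereInner d (fun y => k (sphereIsometry ρ x) (sphereIsometry ρ y)) (k x) =
      k (sphereIsometry ρ x) (sphereIsometry ρ x) := by
    rw [sphereInner_comm]
    exact hrep x _ (hinv ρ _ (hkm _))
  have h2 : sphereInner d (fun y => k (sphereIsometry ρ x) (sphereIsometry ρ y)) (k x) = k x x := by
    have h3 := hrep (sphereIsometry ρ x) _ (hinv ρ.symm _ (hkm x))
    rw [sphereIsometry_apply_symm] at h3
    rw [← h3, sphereInner, sphereInner]
    have h4 := integral_comp_sphereIsometry ρ
      (f := fun y => k (sphereIsometry ρ x) y * k x (sphereIsometry ρ.symm y))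
      ((hcont _ (hkm _)).mul ((hcont _ (hkm x)).comp (continuous_sphereIsometry _)))
    simpa only [sphereIsometry_apply_symm] using h4
  rw [hdiag, hdiag, ← h1, h2]

/-- Rotations act transitively, so the sum is constant and equals its mean, to which each basis
function contributes `1`. -/
theorem sum_sq_eq_card (hd : 1 ≤ d) (hc : ∀ i, Continuous (e i))
    (he : ∀ i j, sphereInner d (e i) (e j) = if i = j then 1 else 0)
    (hinv : ∀ ρ, ∀ f ∈ Submodule.span ℝ (Set.range e),
      (fun x => f (sphereIsometry ρ x)) ∈ Submodule.span ℝ (Set.range e)) (x : UnitSphere d) :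
    ∑ i, e i x ^ 2 = Fintype.card κ := by
  have := isProbabilityMeasure_sphereUniform hd
  have hconst : ∀ y, ∑ i, e i y ^ 2 = ∑ i, e i x ^ 2 := fun y => by
    obtain ⟨ρ, rfl⟩ := exists_sphereIsometry_eq x y
    exact sum_sq_sphereIsometry hc he hinv ρ x
  have h1 : ∫ y, ∑ i, e i y ^ 2 ∂sphereUniform d = ∑ i, e i x ^ 2 := by
    simp_rw [hconst]; simp
  rw [← h1, integral_finsetSum (f := fun i y => e i y ^ 2) _ fun i _ =>
    integrable_sphereUniform_of_continuous ((hc i).pow 2)]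
  have h2 : ∀ i, ∫ y, e i y ^ 2 ∂sphereUniform d = 1 := fun i => by
    have := he i i
    rw [if_pos rfl, sphereInner] at this
    simpa only [sq] using this
  simp [h2]

end Kernel

/-- Needed for the space of all homogeneous polynomials of a given degree, where no basis is given.
The form is definite because the functions are continuous and the measure charges every nonempty
open set. -/
theorem exists_orthonormal_spanning {d : ℕ} (V : Submodule ℝ (UnitSphere d → ℝ))
    [FiniteDimensional ℝ V] (hV : ∀ f ∈ V, Continuous f) :
    ∃ e : Fin (Module.finrank ℝ V) → UnitSphere d → ℝ, (∀ i, Continuous (e i)) ∧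
      (∀ i j, sphereInner d (e i) (e j) = if i = j then 1 else 0) ∧
      Submodule.span ℝ (Set.range e) = V := by
  have : (sphereUniform d).IsOpenPosMeasure := by
    rw [sphereUniform]
    refine Measure.isOpenPosMeasure_smul _ ?_
    exact ENNReal.inv_ne_zero.2 (measure_ne_top _ _)
  have hint : ∀ f g : V, Integrable (fun x => (f : UnitSphere d → ℝ) x * (g : UnitSphere d → ℝ) x)
      (sphereUniform d) := fun f g =>
    integrable_sphereUniform_of_continuous ((hV _ f.2).mul (hV _ g.2))
  let B : LinearMap.BilinForm ℝ V := LinearMap.mk₂ ℝ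
    (fun f g => sphereInner d f g)
    (fun f₁ f₂ g => by
      simp only [sphereInner, Submodule.coe_add, Pi.add_apply, add_mul]
      exact integral_add (hint _ _) (hint _ _))
    (fun c f g => by
      simp only [sphereInner, Submodule.coe_smul, Pi.smul_apply, smul_eq_mul, mul_assoc]
      exact integral_const_mul _ _)
    (fun f g₁ g₂ => by
      simp only [sphereInner, Submodule.coe_add, Pi.add_apply, mul_add]
      exact integral_add (hint _ _) (hint _ _))
    (fun c f g => by
      simp only [sphereInner, Submodule.coe_smul, Pi.smul_apply, smul_eq_mul, mul_left_comm _ c]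
      exact integral_const_mul _ _)
  have hB : ∀ f g : V, B f g = sphereInner d f g := fun f g => rfl
  obtain ⟨v, hv⟩ := LinearMap.BilinForm.exists_orthogonal_basis (B := B)
    ⟨fun f g => sphereInner_comm _ _⟩
  have hpos : ∀ i, 0 < B (v i) (v i) := fun i => by
    have hf := hV _ (v i).2
    rw [hB, sphereInner]
    refine (integral_nonneg fun x => mul_self_nonneg _).lt_of_ne' fun h => ?_
    rw [integral_eq_zero_iff_of_nonneg (fun x => mul_self_nonneg _) (hint _ _)] at h
    have h' := (Continuous.ae_eq_iff_eq (sphereUniform d) (hf.mul hf) continuous_const).1 h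
    refine v.ne_zero i (Subtype.ext (funext fun x => ?_))
    exact mul_self_eq_zero.1 (congrFun h' x)
  have hs : ∀ i, √(B (v i) (v i)) ≠ 0 := fun i => (Real.sqrt_pos.2 (hpos i)).ne'
  refine ⟨fun i => (((√(B (v i) (v i)))⁻¹ • v i : V) : UnitSphere d → ℝ),
    fun i => hV _ (Submodule.coe_mem _), fun i j => ?_, le_antisymm ?_ ?_⟩
  · rw [← hB]
    simp only [map_smul, LinearMap.smul_apply, smul_eq_mul]
    split_ifs with h
    · subst h
      have := Real.mul_self_sqrt (hpos i).le
      field_simp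
      rw [sq, this, div_self (hpos i).ne']
    · rw [hv h]; simp
  · rw [Submodule.span_le]
    rintro _ ⟨i, rfl⟩
    exact Submodule.coe_mem _
  · intro f hf
    have hsum := v.sum_repr ⟨f, hf⟩
    have : f = ∑ i, v.repr ⟨f, hf⟩ i • (v i : UnitSphere d → ℝ) := by
      have h1 := congrArg (Submodule.subtype V) hsum
      rw [map_sum] at h1
      simpa only [map_smul, Submodule.subtype_apply] using h1.symm
    rw [this]
    refine Submodule.sum_mem _ fun i _ => Submodule.smul_mem _ _ ?_
    have h1 := Submodule.smul_mem (Submodule.span ℝ (Set.range fun i =>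
      (((√(B (v i) (v i)))⁻¹ • v i : V) : UnitSphere d → ℝ))) (√(B (v i) (v i)))
      (Submodule.subset_span ⟨i, rfl⟩)
    simpa [smul_smul, hs i] using h1

theorem sq_le_finrank_mul_sphereInner {d : ℕ} (hd : 1 ≤ d) (V : Submodule ℝ (UnitSphere d → ℝ))
    [FiniteDimensional ℝ V] (hV : ∀ f ∈ V, Continuous f)
    (hinv : ∀ ρ, ∀ f ∈ V, (fun x => f (sphereIsometry ρ x)) ∈ V) {f : UnitSphere d → ℝ}
    (hf : f ∈ V) (x : UnitSphere d) :
    f x ^ 2 ≤ Module.finrank ℝ V * sphereInner d f f := by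
  obtain ⟨e, hc, he, hspan⟩ := exists_orthonormal_spanning V hV
  have hcard := sum_sq_eq_card hd hc he (by rwa [hspan]) x
  rw [← hspan, Submodule.mem_span_range_iff_exists_fun] at hf
  obtain ⟨a, ha⟩ := hf
  have hfa : f = fun x => ∑ i, a i * e i x := by rw [← ha]; ext x; simp
  have := sq_le_sum_sq_mul_sphereInner hc he a x
  rw [hcard, Fintype.card_fin] at this
  rw [hfa]
  exact this

/-! ### Polynomials on the sphere -/

section Polynomials

variable {d : ℕ}

theorem continuous_restrictToSphere (p : MvPolynomial (Fin d) ℝ) :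
    Continuous (restrictToSphere d p) := by
  change Continuous fun x : UnitSphere d => MvPolynomial.eval (fun i => (x : EuclideanSpace ℝ (Fin d)) i) p
  have h := MvPolynomial.continuous_eval p
  exact h.comp (by fun_prop)

/-- Linear substitution of variables in a polynomial by a matrix. -/
noncomputable def linearSubst (A : Matrix (Fin d) (Fin d) ℝ) :
    MvPolynomial (Fin d) ℝ →ₐ[ℝ] MvPolynomial (Fin d) ℝ :=
  MvPolynomial.aeval fun i => ∑ j, MvPolynomial.C (A i j) * MvPolynomial.X j

theorem pderiv_linearSubst (A : Matrix (Fin d) (Fin d) ℝ) (j : Fin d)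
    (p : MvPolynomial (Fin d) ℝ) :
    MvPolynomial.pderiv j (linearSubst A p) =
      ∑ i, MvPolynomial.C (A i j) * linearSubst A (MvPolynomial.pderiv i p) := by
  induction p using MvPolynomial.induction_on with
  | C a =>
    simp [linearSubst, MvPolynomial.algebraMap_eq]
  | add p q hp hq => simp [hp, hq, mul_add, Finset.sum_add_distrib]
  | mul_X p n hp =>
    have hX : linearSubst A (MvPolynomial.X n) =
        ∑ j, MvPolynomial.C (A n j) * MvPolynomial.X j := by simp [linearSubst]
    have hd : MvPolynomial.pderiv j (linearSubst A (MvPolynomial.X n)) =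
        MvPolynomial.C (A n j) := by
      rw [hX, map_sum]
      simp [MvPolynomial.pderiv_X, Pi.single_apply]
    rw [map_mul, MvPolynomial.pderiv_mul, hp, hd]
    simp only [MvPolynomial.pderiv_mul, map_add, map_mul, mul_add, Finset.sum_add_distrib,
      MvPolynomial.pderiv_X, Finset.sum_mul]
    congr 1
    · exact Finset.sum_congr rfl fun i _ => by ring
    · rw [Finset.sum_eq_single n]
      · simp [mul_comm]
      · intro b _ hb
        simp [hb.symm]
      · simp

/-- Apply the chain rule twice; orthonormality of the rows of `A` collapses the double sum. -/
theorem polyLaplacian_linearSubst {A : Matrix (Fin d) (Fin d) ℝ}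
    (hA : ∀ i l, ∑ j, A i j * A l j = if i = l then 1 else 0) (p : MvPolynomial (Fin d) ℝ) :
    polyLaplacian d (linearSubst A p) = linearSubst A (polyLaplacian d p) := by
  have hsimp : ∀ q, polyLaplacian d q =
      ∑ i, MvPolynomial.pderiv i (MvPolynomial.pderiv i q) := fun q => by
    simp [polyLaplacian, LinearMap.sum_apply]
  have hj : ∀ j, MvPolynomial.pderiv j (MvPolynomial.pderiv j (linearSubst A p)) =
      ∑ i, ∑ l, MvPolynomial.C (A i j * A l j) *
        linearSubst A (MvPolynomial.pderiv l (MvPolynomial.pderiv i p)) := fun j => by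
    rw [pderiv_linearSubst, map_sum]
    refine Finset.sum_congr rfl fun i _ => ?_
    rw [MvPolynomial.pderiv_C_mul, pderiv_linearSubst, Finset.mul_sum]
    exact Finset.sum_congr rfl fun l _ => by rw [map_mul]; ring
  rw [hsimp, hsimp, map_sum]
  simp_rw [hj]
  rw [Finset.sum_comm]
  refine Finset.sum_congr rfl fun i _ => ?_
  rw [Finset.sum_comm]
  simp_rw [← Finset.sum_mul, ← map_sum, hA]
  simp

theorem isHomogeneous_linearSubst (A : Matrix (Fin d) (Fin d) ℝ) {p : MvPolynomial (Fin d) ℝ}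
    {m : ℕ} (hp : p.IsHomogeneous m) : (linearSubst A p).IsHomogeneous m := by
  have := hp.aeval (n := 1) (fun i => ∑ j, MvPolynomial.C (A i j) * MvPolynomial.X j)
    (fun i => MvPolynomial.IsHomogeneous.sum _ _ _ fun j _ =>
      MvPolynomial.isHomogeneous_C_mul_X _ _)
  rwa [one_mul] at this

/-- The matrix of a linear isometry in the standard basis. -/
noncomputable def isometryMatrix
    (ρ : EuclideanSpace ℝ (Fin d) ≃ₗᵢ[ℝ] EuclideanSpace ℝ (Fin d)) : Matrix (Fin d) (Fin d) ℝ :=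
  fun i j => ρ (EuclideanSpace.single j 1) i

theorem restrictToSphere_comp_sphereIsometry
    (ρ : EuclideanSpace ℝ (Fin d) ≃ₗᵢ[ℝ] EuclideanSpace ℝ (Fin d)) (p : MvPolynomial (Fin d) ℝ) :
    (fun x => restrictToSphere d p (sphereIsometry ρ x)) =
      restrictToSphere d (linearSubst (isometryMatrix ρ) p) := by
  ext x
  change MvPolynomial.eval (fun i => ρ (x : EuclideanSpace ℝ (Fin d)) i) p =
    MvPolynomial.eval (fun i => (x : EuclideanSpace ℝ (Fin d)) i) (linearSubst _ p)
  have h : ∀ i, ρ (x : EuclideanSpace ℝ (Fin d)) i =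
      ∑ j, isometryMatrix ρ i j * (x : EuclideanSpace ℝ (Fin d)) j := fun i => by
    have hx : (x : EuclideanSpace ℝ (Fin d)) =
        ∑ j, (x : EuclideanSpace ℝ (Fin d)) j • EuclideanSpace.single j (1 : ℝ) := by
      have := (EuclideanSpace.basisFun (Fin d) ℝ).sum_repr (x : EuclideanSpace ℝ (Fin d))
      simpa using this.symm
    conv_lhs => rw [hx]
    simp [isometryMatrix, mul_comm]
  rw [linearSubst, MvPolynomial.aeval_def, MvPolynomial.eval₂_eq', map_sum, MvPolynomial.eval_eq']
  simp [h]

/-- The inverse of an isometry is its adjoint, so the rows are the images of the standard basis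
vectors under `ρ.symm`. -/
theorem isometryMatrix_rows
    (ρ : EuclideanSpace ℝ (Fin d) ≃ₗᵢ[ℝ] EuclideanSpace ℝ (Fin d)) (i l : Fin d) :
    ∑ j, isometryMatrix ρ i j * isometryMatrix ρ l j = if i = l then 1 else 0 := by
  have h : ∀ i j, isometryMatrix ρ i j = ρ.symm (EuclideanSpace.single i 1) j := fun i j => by
    have := ρ.inner_map_map (ρ.symm (EuclideanSpace.single i 1)) (EuclideanSpace.single j 1)
    rw [ρ.apply_symm_apply] at this
    simpa [isometryMatrix, EuclideanSpace.inner_single_left, EuclideanSpace.inner_single_right]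
      using this
  simp_rw [h]
  have := ρ.symm.inner_map_map (EuclideanSpace.single l 1) (EuclideanSpace.single i (1 : ℝ))
  rw [PiLp.inner_apply] at this
  simp only [RCLike.inner_apply, conj_trivial] at this
  rw [this]
  simp [EuclideanSpace.inner_single_left, eq_comm]

theorem comp_sphereIsometry_mem_sphericalHarmonics {k : ℕ}
    (ρ : EuclideanSpace ℝ (Fin d) ≃ₗᵢ[ℝ] EuclideanSpace ℝ (Fin d)) {f : UnitSphere d → ℝ}
    (hf : f ∈ sphericalHarmonics d k) :
    (fun x => f (sphereIsometry ρ x)) ∈ sphericalHarmonics d k := by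
  obtain ⟨p, ⟨hp, hl⟩, rfl⟩ := hf
  rw [restrictToSphere_comp_sphereIsometry]
  refine Submodule.mem_map_of_mem ⟨?_, ?_⟩
  · exact isHomogeneous_linearSubst _ hp
  · have hl' : polyLaplacian d p = 0 := hl
    change polyLaplacian d _ = 0
    rw [polyLaplacian_linearSubst (isometryMatrix_rows ρ), hl', map_zero]

/-- The restrictions to the sphere of the homogeneous polynomials of degree `m`. -/
noncomputable def sphereHomogeneous (d m : ℕ) : Submodule ℝ (UnitSphere d → ℝ) :=
  (MvPolynomial.homogeneousSubmodule (Fin d) ℝ m).map (restrictToSphere d)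

/-- Each exponent of a monomial of degree `m` is at most `m`. This gives the crude dimension bound
`(m+1)^d`, which suffices. -/
theorem sphereHomogeneous_le_span (d m : ℕ) :
    sphereHomogeneous d m ≤ Submodule.span ℝ (Set.range fun α : Fin d → Fin (m + 1) =>
      restrictToSphere d
        (MvPolynomial.monomial (Finsupp.equivFunOnFinite.symm fun i => (α i : ℕ)) 1)) := by
  rintro _ ⟨p, hp, rfl⟩
  have hp' : p.IsHomogeneous m := hp
  have hsum := congrArg (restrictToSphere d) p.as_sum
  rw [map_sum] at hsum
  rw [hsum]
  refine Submodule.sum_mem _ fun α hα => ?_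
  have hdeg : α.degree = m := by
    have := hp' (MvPolynomial.mem_support_iff.1 hα)
    rw [Finsupp.degree_eq_weight_one (R := ℕ)]
    exact this
  have hle : ∀ i, α i < m + 1 := fun i => by
    have := Finsupp.le_degree i α
    omega
  have : MvPolynomial.monomial α (MvPolynomial.coeff α p) =
      MvPolynomial.coeff α p • MvPolynomial.monomial α (1 : ℝ) := by
    simp [MvPolynomial.smul_monomial]
  rw [this, map_smul]
  have hα : Finsupp.equivFunOnFinite.symm (fun i => α i) = α := by ext i; simp
  refine Submodule.smul_mem _ _ (Submodule.subset_span ⟨fun i => ⟨α i, hle i⟩, ?_⟩)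
  simp only [hα]

theorem sq_le_of_isHomogeneous (hd : 1 ≤ d) {m : ℕ} {p : MvPolynomial (Fin d) ℝ}
    (hp : p.IsHomogeneous m) (x : UnitSphere d) :
    restrictToSphere d p x ^ 2 ≤
      ((m : ℝ) + 1) ^ d * sphereInner d (restrictToSphere d p) (restrictToSphere d p) := by
  have hle := sphereHomogeneous_le_span d m
  have : FiniteDimensional ℝ (Submodule.span ℝ (Set.range fun α : Fin d → Fin (m + 1) =>
      restrictToSphere d
        (MvPolynomial.monomial (Finsupp.equivFunOnFinite.symm fun i => (α i : ℕ)) 1))) :=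
    FiniteDimensional.span_of_finite ℝ (Set.finite_range _)
  have : FiniteDimensional ℝ (sphereHomogeneous d m) := Submodule.finiteDimensional_of_le hle
  have h := sq_le_finrank_mul_sphereInner hd (sphereHomogeneous d m)
    (by rintro _ ⟨q, -, rfl⟩; exact continuous_restrictToSphere q)
    (by
      rintro ρ _ ⟨q, hq, rfl⟩
      rw [restrictToSphere_comp_sphereIsometry]
      exact Submodule.mem_map_of_mem (isHomogeneous_linearSubst _ hq))
    (Submodule.mem_map_of_mem (f := restrictToSphere d) hp) x
  have hdim : Module.finrank ℝ (sphereHomogeneous d m) ≤ (m + 1) ^ d := by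
    refine (Submodule.finrank_mono hle).trans ((finrank_range_le_card _).trans ?_)
    simp
  refine h.trans (mul_le_mul_of_nonneg_right (by exact_mod_cast hdim) ?_)
  exact integral_nonneg fun x => mul_self_nonneg _

theorem continuous_of_mem_sphericalHarmonics {k : ℕ} {f : UnitSphere d → ℝ}
    (hf : f ∈ sphericalHarmonics d k) : Continuous f := by
  obtain ⟨p, -, rfl⟩ := hf
  exact continuous_restrictToSphere p

/-- A Nikolskii inequality for spherical harmonics. -/
theorem pow_two_mul_le_of_mem_sphericalHarmonics (hd : 1 ≤ d) {k : ℕ} {f : UnitSphere d → ℝ}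
    (hf : f ∈ sphericalHarmonics d k) (n : ℕ) (x : UnitSphere d) :
    (f x ^ 2) ^ n ≤ ((k : ℝ) * n + 1) ^ d * ∫ y, (f y ^ 2) ^ n ∂sphereUniform d := by
  obtain ⟨p, ⟨hp, -⟩, rfl⟩ := hf
  have hp' : p.IsHomogeneous k := hp
  -- The power `p ^ n` need not be harmonic, but it is homogeneous of degree `k * n`; hence the
  -- bound for all homogeneous polynomials.
  have hpow : ∀ y, restrictToSphere d (p ^ n) y = restrictToSphere d p y ^ n := fun y => by
    simp [restrictToSphere]
  have h := sq_le_of_isHomogeneous hd (hp'.pow n) x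
  simp only [sphereInner, hpow] at h
  push_cast at h
  simp_rw [← sq, ← pow_mul, mul_comm n 2, pow_mul] at h
  exact h

end Polynomials

/-! ### Random spherical harmonics -/

theorem one_lt_log_three_div_add {δ : ℝ} (hδ : 0 < δ) (hδ1 : δ < 1) (d k : ℕ) :
    1 < Real.log (3 / δ) + 2 * (d : ℝ) ^ 2 * Real.log ((k : ℝ) + 1) := by
  have hlog3 : 1 < Real.log (3 / δ) := by
    rw [Real.lt_log_iff_exp_lt (by positivity)]
    have h3 : 3 < 3 / δ := by rw [lt_div_iff₀ hδ]; linarith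
    exact Real.exp_one_lt_three.trans h3
  have : 0 ≤ 2 * (d : ℝ) ^ 2 * Real.log ((k : ℝ) + 1) :=
    mul_nonneg (by positivity) (Real.log_nonneg (by simp))
  linarith

/-- For `5L ≤ p ≤ 6L` one has `4p ≤ 25L` and `exp (-p) ≤ exp (-5L)`, while the dimension factor
costs at most `exp (3L)`. What remains is `2 exp (-2L) ≤ 2δ/3`. -/
theorem pow_mul_exp_neg_le {d k : ℕ} {δ L : ℝ} (hδ : 0 < δ) (hδ1 : δ < 1)
    (hL : L = Real.log (3 / δ) + 2 * (d : ℝ) ^ 2 * Real.log ((k : ℝ) + 1)) {p : ℕ}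
    (hp : 5 * L ≤ p) (hp' : (p : ℝ) ≤ 6 * L) :
    ((k : ℝ) * p + 1) ^ d * (2 * (4 * p * Real.exp (-1)) ^ p) ≤ δ * (25 * L) ^ p := by
  have hlogk : 0 ≤ Real.log ((k : ℝ) + 1) := Real.log_nonneg (by simp)
  have hlog3 : 0 ≤ Real.log (3 / δ) :=
    Real.log_nonneg (by rw [le_div_iff₀ hδ]; linarith)
  have hL1 : 1 < L := hL ▸ one_lt_log_three_div_add hδ hδ1 d k
  have hδL : Real.exp (-L) ≤ δ / 3 := by
    have : -L ≤ Real.log (δ / 3) := by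
      rw [← inv_div, Real.log_inv, hL]
      have : 0 ≤ 2 * (d : ℝ) ^ 2 * Real.log ((k : ℝ) + 1) := by positivity
      linarith
    exact (Real.le_log_iff_exp_le (by positivity)).1 this
  have hpow : (4 * p * Real.exp (-1)) ^ p ≤ (25 * L) ^ p * Real.exp (-(5 * L)) := by
    rw [mul_pow, ← Real.exp_nat_mul]
    refine mul_le_mul (pow_le_pow_left₀ (by positivity) (by linarith) _)
      (Real.exp_le_exp.2 (by linarith)) (Real.exp_pos _).le (by positivity)
  -- For `k ≥ 1`, `2 ln 2 > 1` gives `d² ≤ L`. Then `(k+1)^d ≤ exp L`, and `p ≤ 6L ≤ exp (2√L)` with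
  -- `d ≤ √L` gives `p^d ≤ exp (2L)`.
  have hdim : ((k : ℝ) * p + 1) ^ d ≤ Real.exp (3 * L) := by
    rcases Nat.eq_zero_or_pos k with rfl | hk
    · simp only [CharP.cast_eq_zero, zero_mul, zero_add, one_pow]
      exact Real.one_le_exp (by linarith)
    have hd2 : (d : ℝ) ≤ (d : ℝ) ^ 2 := by exact_mod_cast Nat.le_self_pow two_ne_zero d
    have hk2 : Real.log 2 ≤ Real.log ((k : ℝ) + 1) := by
      refine Real.log_le_log (by norm_num) ?_
      have : (1 : ℝ) ≤ k := by exact_mod_cast hk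
      linarith
    have hdL : (d : ℝ) ^ 2 ≤ L := by
      have h2 := Real.log_two_gt_d9
      nlinarith [sq_nonneg (d : ℝ)]
    have hkL : ((k : ℝ) + 1) ^ d ≤ Real.exp L := by
      rw [← Real.exp_log (show (0 : ℝ) < (k : ℝ) + 1 by positivity), ← Real.exp_nat_mul]
      refine Real.exp_le_exp.2 ?_
      nlinarith
    have hs := Real.sq_sqrt (show 0 ≤ L by linarith)
    have hds : (d : ℝ) * √L ≤ L := by
      have : (d : ℝ) ≤ √L := Real.le_sqrt_of_sq_le hdL
      nlinarith [Real.sqrt_nonneg L]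
    have hpe : (p : ℝ) ≤ Real.exp (2 * √L) := by
      have h1 : √L ≤ Real.exp (√L - 1) := by
        have := Real.add_one_le_exp (√L - 1); linarith
      have h2 : L ≤ Real.exp (√L - 1) ^ 2 := by
        exact hs.ge.trans (pow_le_pow_left₀ (Real.sqrt_nonneg _) h1 2)
      have h3 : 6 ≤ Real.exp 1 ^ 2 := by
        have := Real.exp_one_gt_d9
        nlinarith
      have h4 : Real.exp (2 * √L) = Real.exp 1 ^ 2 * Real.exp (√L - 1) ^ 2 := by
        rw [← mul_pow, ← Real.exp_add, ← Real.exp_nat_mul]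
        congr 1
        push_cast; ring
      rw [h4]
      refine hp'.trans (mul_le_mul h3 h2 (by linarith) (by positivity))
    have hp1 : (1 : ℝ) ≤ p := by linarith
    calc ((k : ℝ) * p + 1) ^ d ≤ (((k : ℝ) + 1) * p) ^ d := by gcongr; linarith
      _ = ((k : ℝ) + 1) ^ d * (p : ℝ) ^ d := mul_pow _ _ _
      _ ≤ Real.exp L * Real.exp (2 * √L) ^ d := by gcongr
      _ = Real.exp (L + d * (2 * √L)) := by rw [← Real.exp_nat_mul, ← Real.exp_add]
      _ ≤ Real.exp (3 * L) := Real.exp_le_exp.2 (by linarith)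
  calc ((k : ℝ) * p + 1) ^ d * (2 * (4 * p * Real.exp (-1)) ^ p)
      ≤ Real.exp (3 * L) * (2 * ((25 * L) ^ p * Real.exp (-(5 * L)))) := by gcongr
    _ = 2 * Real.exp (-(2 * L)) * (25 * L) ^ p := by
      have : Real.exp (-(2 * L)) = Real.exp (3 * L) * Real.exp (-(5 * L)) := by
        rw [← Real.exp_add]; ring_nf
      rw [this]; ring
    _ ≤ δ * (25 * L) ^ p := by
      have h1 : Real.exp (-(2 * L)) ≤ Real.exp (-L) := Real.exp_le_exp.2 (by linarith)
      have : 2 * Real.exp (-(2 * L)) ≤ δ := by linarith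
      gcongr

section RandomHarmonic

variable {d : ℕ} {ι : Type*} [Fintype ι] {e : ι → UnitSphere d → ℝ}

theorem sphereL2Norm_sum [DecidableEq ι] (hc : ∀ i, Continuous (e i))
    (he : ∀ i j, sphereInner d (e i) (e j) = if i = j then 1 else 0) (a : ι → ℝ) :
    sphereL2Norm d (fun x => ∑ i, a i * e i x) = ENNReal.ofReal √(∑ i, a i ^ 2) := by
  have hcont : Continuous (fun x => ∑ i, a i * e i x) :=
    continuous_finsetSum _ fun i _ => (hc i).const_mul _
  have hmem : MemLp (fun x => ∑ i, a i * e i x) 2 (sphereUniform d) :=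
    (memLp_two_iff_integrable_sq hcont.aestronglyMeasurable).2
      (integrable_sphereUniform_of_continuous (hcont.pow 2))
  have hin := sphereInner_sum_sum hc he a a
  simp only [sphereInner, ← sq] at hin
  rw [sphereL2Norm, hmem.eLpNorm_eq_integral_rpow_norm two_ne_zero ENNReal.ofNat_ne_top]
  simp only [ENNReal.toReal_ofNat, Real.rpow_ofNat, Real.norm_eq_abs, sq_abs]
  rw [hin, Real.sqrt_eq_rpow, one_div]

/-- The average over the sphere of the moments of the normalized random function. -/
theorem lintegral_ratio_pow_le [Nonempty ι] (hd : 1 ≤ d) (hc : ∀ i, Continuous (e i))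
    (hsum : ∀ x, ∑ i, e i x ^ 2 = Fintype.card ι) {p : ℕ} (hp : 0 < p) :
    ∫⁻ a, ∫⁻ x, ENNReal.ofReal (((∑ i, a i * e i x) ^ 2 / ∑ i, a i ^ 2) ^ p) ∂sphereUniform d
        ∂Measure.pi (fun _ : ι => gaussianReal 0 1) ≤
      ENNReal.ofReal (2 * (4 * p * Real.exp (-1)) ^ p) := by
  have := isProbabilityMeasure_sphereUniform hd
  have hem : ∀ i, Measurable (e i) := fun i => (hc i).measurable
  -- By Tonelli it suffices to fix `x`; the vector of values `e i x` then has squared length `N`.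
  rw [lintegral_lintegral_swap (Measurable.aemeasurable (by fun_prop))]
  have hx : ∀ x, ∫⁻ a, ENNReal.ofReal (((∑ i, a i * e i x) ^ 2 / ∑ i, a i ^ 2) ^ p)
      ∂Measure.pi (fun _ : ι => gaussianReal 0 1) ≤
      ENNReal.ofReal (2 * (4 * p * Real.exp (-1)) ^ p) := fun x => by
    have q0 : ∀ a : ι → ℝ, 0 ≤ ∑ i, a i ^ 2 := fun a => Finset.sum_nonneg fun i _ => sq_nonneg _
    have h0 : ∀ a : ι → ℝ, 0 ≤ ((∑ i, a i * e i x) ^ 2 / ∑ i, a i ^ 2) ^ p := fun a =>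
      pow_nonneg (div_nonneg (sq_nonneg _) (q0 a)) _
    rw [← ofReal_integral_eq_lintegral_ofReal _ (ae_of_all _ h0)]
    · exact ENNReal.ofReal_le_ofReal (integral_ratio_pow_pi_gaussianReal_le (hsum x) hp)
    · refine Integrable.of_bound (Measurable.aestronglyMeasurable (by fun_prop))
        ((Fintype.card ι : ℝ) ^ p) (ae_of_all _ fun a => ?_)
      rw [Real.norm_of_nonneg (h0 a)]
      refine pow_le_pow_left₀ (div_nonneg (sq_nonneg _) (q0 a))
        (div_le_of_le_mul₀ (q0 a) (Nat.cast_nonneg _) ?_) _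
      rw [mul_comm, ← hsum x]
      exact Finset.sum_mul_sq_le_sq_mul_sq _ _ _
  calc _ ≤ ∫⁻ _x : UnitSphere d, ENNReal.ofReal (2 * (4 * p * Real.exp (-1)) ^ p)
        ∂sphereUniform d := lintegral_mono hx
    _ = _ := by simp

theorem exists_sq_gt_of_sphereSupNorm_gt [DecidableEq ι] (hc : ∀ i, Continuous (e i))
    (he : ∀ i j, sphereInner d (e i) (e j) = if i = j then 1 else 0) {t : ℝ} (ht : 0 ≤ t)
    {a : ι → ℝ} (h : ¬ sphereSupNorm d (fun x => ∑ j, a j * e j x) ≤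
      ENNReal.ofReal t * sphereL2Norm d (fun x => ∑ j, a j * e j x)) :
    ∃ x, t ^ 2 * ∑ i, a i ^ 2 < (∑ j, a j * e j x) ^ 2 := by
  rw [sphereSupNorm, not_le, lt_iSup_iff] at h
  obtain ⟨x, hx⟩ := h
  refine ⟨x, ?_⟩
  have q0 : 0 ≤ ∑ i, a i ^ 2 := Finset.sum_nonneg fun i _ => sq_nonneg _
  rw [sphereL2Norm_sum hc he, ← ENNReal.ofReal_mul ht, Real.enorm_eq_ofReal_abs,
    ENNReal.ofReal_lt_ofReal_iff_of_nonneg (by positivity)] at hx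
  have := pow_lt_pow_left₀ hx (by positivity) two_ne_zero
  rwa [mul_pow, Real.sq_sqrt q0, sq_abs] at this

end RandomHarmonic

/-- A moment bound for the probability that the normalized supremum of a random spherical
harmonic is large. -/
theorem measure_sphereSupNorm_gt_le {d : ℕ} (hd : 1 ≤ d) {k : ℕ} {ι : Type*} [Fintype ι]
    [DecidableEq ι] (Y : Module.Basis ι ℝ (sphericalHarmonics d k))
    (hY : ∀ i j, sphereInner d (Y i) (Y j) = if i = j then 1 else 0) {p : ℕ} (hp : 0 < p)
    {t : ℝ} (ht : 0 < t) {Ω : Type*} [MeasurableSpace Ω] {P : Measure Ω} {A : Ω → ι → ℝ}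
    (hA : HasLaw A (Measure.pi fun _ : ι => gaussianReal 0 1) P) :
    P {ω | ¬ sphereSupNorm d (fun x => ∑ j, A ω j * (Y j : UnitSphere d → ℝ) x) ≤
        ENNReal.ofReal t * sphereL2Norm d (fun x => ∑ j, A ω j * (Y j : UnitSphere d → ℝ) x)} ≤
      ENNReal.ofReal (((k : ℝ) * p + 1) ^ d * (2 * (4 * p * Real.exp (-1)) ^ p) / t ^ (2 * p)) := by
  have := isProbabilityMeasure_sphereUniform hd
  set e : ι → UnitSphere d → ℝ := fun i => Y i with he_def
  have hc : ∀ i, Continuous (e i) := fun i => continuous_of_mem_sphericalHarmonics (Y i).2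
  have hem : ∀ i, Measurable (e i) := fun i => (hc i).measurable
  -- If the space of harmonics is trivial, `g = 0` and the bad event is empty.
  rcases isEmpty_or_nonempty ι with hι | hι
  · simp [sphereSupNorm]
  have hspan : Submodule.span ℝ (Set.range e) = sphericalHarmonics d k := by
    have h := congrArg (Submodule.map (sphericalHarmonics d k).subtype) Y.span_eq
    rw [Submodule.map_span, ← Set.range_comp, Submodule.map_top, Submodule.range_subtype] at h
    exact h
  have hsum := sum_sq_eq_card hd hc hY (by
    intro ρ f hf
    rw [hspan] at hf ⊢
    exact comp_sphereIsometry_mem_sphericalHarmonics ρ hf)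
  set D : ℝ := ((k : ℝ) * p + 1) ^ d
  have hD : 0 < D := by positivity
  set K : ℝ := 2 * (4 * p * Real.exp (-1)) ^ p
  set Φ : (ι → ℝ) → ℝ≥0∞ := fun a =>
    ∫⁻ x, ENNReal.ofReal (((∑ i, a i * e i x) ^ 2 / ∑ i, a i ^ 2) ^ p) ∂sphereUniform d
  have hΦ : Measurable Φ := Measurable.lintegral_prod_right' (f := fun z : (ι → ℝ) × UnitSphere d =>
    ENNReal.ofReal (((∑ i, z.1 i * e i z.2) ^ 2 / ∑ i, z.1 i ^ 2) ^ p)) (by fun_prop)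
  -- One large value of `g` forces, by the Nikolskii inequality, a large spherical average `Φ a`, to
  -- which Markov's inequality applies.
  have hbad : ∀ a : ι → ℝ, ¬ sphereSupNorm d (fun x => ∑ j, a j * e j x) ≤
        ENNReal.ofReal t * sphereL2Norm d (fun x => ∑ j, a j * e j x) →
      ENNReal.ofReal (t ^ (2 * p) / D) ≤ Φ a := fun a ha => by
    obtain ⟨x, hx⟩ := exists_sq_gt_of_sphereSupNorm_gt hc hY ht.le ha
    have q0 : 0 ≤ ∑ i, a i ^ 2 := Finset.sum_nonneg fun i _ => sq_nonneg _
    have q1 : 0 < ∑ i, a i ^ 2 := by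
      refine q0.lt_of_ne' fun hq => ?_
      have h0 : ∀ i, a i = 0 := fun i => pow_eq_zero_iff two_ne_zero |>.1 <|
        (Finset.sum_eq_zero_iff_of_nonneg fun i _ => sq_nonneg (a i)).1 hq i (Finset.mem_univ i)
      simp [h0] at hx
    have hf : (fun x => ∑ i, a i * e i x) ∈ sphericalHarmonics d k := by
      have h := (∑ i, a i • Y i).2
      have hfun : (fun x => ∑ i, a i * e i x) =
          ((∑ i, a i • Y i : sphericalHarmonics d k) : UnitSphere d → ℝ) := by
        ext x
        simp [e]
      rwa [hfun]
    have hnik := pow_two_mul_le_of_mem_sphericalHarmonics hd hf p x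
    have hcont : Continuous (fun x => ∑ i, a i * e i x) := continuous_of_mem_sphericalHarmonics hf
    have hΦa : Φ a = ENNReal.ofReal
        ((∫ y, ((∑ i, a i * e i y) ^ 2) ^ p ∂sphereUniform d) / (∑ i, a i ^ 2) ^ p) := by
      rw [← integral_div, ofReal_integral_eq_lintegral_ofReal]
      · simp only [Φ, div_pow]
      · exact integrable_sphereUniform_of_continuous (((hcont.pow 2).pow p).div_const _)
      · exact ae_of_all _ fun y => by positivity
    rw [hΦa]
    refine ENNReal.ofReal_le_ofReal ?_
    rw [div_le_div_iff₀ hD (by positivity), pow_mul, ← mul_pow, mul_comm _ D]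
    exact (pow_le_pow_left₀ (by positivity) hx.le p).trans hnik
  have hsub : P {ω | ¬ sphereSupNorm d (fun x => ∑ j, A ω j * e j x) ≤
        ENNReal.ofReal t * sphereL2Norm d (fun x => ∑ j, A ω j * e j x)} ≤
      P {ω | ENNReal.ofReal (t ^ (2 * p) / D) ≤ Φ (A ω)} :=
    measure_mono fun ω hω => hbad _ hω
  refine hsub.trans ?_
  have hlaw : ∫⁻ ω, Φ (A ω) ∂P ≤ ENNReal.ofReal K := by
    have h := hA.lintegral_comp (f := Φ) hΦ.aemeasurable
    rw [h]
    exact lintegral_ratio_pow_le hd hc hsum hp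
  have hmarkov := mul_meas_ge_le_lintegral₀ (hΦ.comp_aemeasurable hA.aemeasurable)
    (ENNReal.ofReal (t ^ (2 * p) / D))
  have hpos : 0 < t ^ (2 * p) / D := by positivity
  rw [show D * K / t ^ (2 * p) = K / (t ^ (2 * p) / D) by field_simp,
    ENNReal.ofReal_div_of_pos hpos, ENNReal.le_div_iff_mul_le
      (Or.inl (ENNReal.ofReal_pos.2 hpos).ne') (Or.inl ENNReal.ofReal_ne_top), mul_comm]
  exact hmarkov.trans hlaw

theorem lemma4 (d : ℕ) (hd : 1 ≤ d) (k : ℕ)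
    {ι : Type*} [Fintype ι] [DecidableEq ι]
    (Y : Module.Basis ι ℝ (sphericalHarmonics d k))
    (hY : ∀ i j, sphereInner d (Y i) (Y j) = if i = j then 1 else 0)
    {Ω : Type*} [MeasurableSpace Ω] (P : Measure Ω) [IsProbabilityMeasure P]
    (a : ι → Ω → ℝ) (ha_law : ∀ j, HasLaw (a j) (gaussianReal 0 1) P)
    (ha_indep : iIndepFun a P)
    (δ : ℝ) (hδ : 0 < δ) :
    ENNReal.ofReal (1 - δ) ≤
      P {ω | sphereSupNorm d (fun x => ∑ j, a j ω * (Y j : UnitSphere d → ℝ) x) ≤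
        ENNReal.ofReal (5 * √(Real.log (3 / δ) + 2 * (d : ℝ) ^ 2 * Real.log ((k : ℝ) + 1))) *
          sphereL2Norm d (fun x => ∑ j, a j ω * (Y j : UnitSphere d → ℝ) x)} := by
  rcases le_or_gt 1 δ with hδ1 | hδ1
  · rw [ENNReal.ofReal_of_nonpos (by linarith)]
    exact zero_le
  set L := Real.log (3 / δ) + 2 * (d : ℝ) ^ 2 * Real.log ((k : ℝ) + 1) with hL
  have hL1 : 1 < L := one_lt_log_three_div_add hδ hδ1 d k
  have hp1 : 5 * L ≤ (⌈5 * L⌉₊ : ℝ) := Nat.le_ceil _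
  -- Rounding up costs less than `1 < L`.
  have hp2 : (⌈5 * L⌉₊ : ℝ) ≤ 6 * L := by
    have := Nat.ceil_lt_add_one (show 0 ≤ 5 * L by linarith)
    linarith
  set p := ⌈5 * L⌉₊
  have hp : 0 < p := Nat.ceil_pos.2 (by linarith)
  have hbad := measure_sphereSupNorm_gt_le hd Y hY hp (t := 5 * √L)
    (by have := Real.sqrt_pos.2 (show 0 < L by linarith); positivity)
    (ha_indep.hasLaw_pi ha_law)
  have hnum := pow_mul_exp_neg_le hδ hδ1 hL hp1 hp2
  have hle : ((k : ℝ) * p + 1) ^ d * (2 * (4 * p * Real.exp (-1)) ^ p) / (5 * √L) ^ (2 * p) ≤ δ := by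
    rw [div_le_iff₀ (by have := Real.sqrt_pos.2 (show 0 < L by linarith); positivity), pow_mul,
      mul_pow 5, Real.sq_sqrt (by linarith), show (5 : ℝ) ^ 2 = 25 by norm_num]
    exact hnum
  have hbad' := hbad.trans (ENNReal.ofReal_le_ofReal hle)
  -- Subadditivity over the good event and its complement avoids any measurability of the event.
  rw [ENNReal.ofReal_sub _ hδ.le, ENNReal.ofReal_one, tsub_le_iff_right, ← measure_univ (μ := P)]
  refine le_trans ?_ (add_le_add_right hbad' _)
  refine le_trans (measure_mono fun ω _ => ?_) (measure_union_le _ _)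
  exact em _
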